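/- Let $B$ be a unital C*-algebra with an AF-action. Then $B$ is singly generated: there is $g\in B$ such that the smallest C*-subalgebra of $B$ containing $g$ is $B$ itself. Here $B$ has an AF-action if it contains an infinite-dimensional simple separable unital AF subalgebra $A$ and a separable unital C*-subalgebra $D$ (both with the unit of $B$), such that the following holds for some canonical inductive limit decomposition $A=\varinjlim_i\big(\bigoplus_{1\le j\le K_i}M_{n_{i,j}}(\mathbb C),\phi_i\big)$, $n_{i,j}\ge 1$. Canonical means that each $\phi_i$ is unital and that, for all $j'$ and $j$, its component from $M_{n_{i,j'}}$ to $M_{n_{i+1,j}}$ repeats a matrix some number $m_{i;j',j}\ge 0$ of times down the diagonal; the positions of all the blocks together are given, for each $j$, by a permutation of the standard basis. Let $V_{i,j}\subseteq A$ be the set of images in $A$ of the standard matrix units of $M_{n_{i,j}}(\mathbb C)$, let $V=\bigcup_{i,j}V_{i,j}$ and $E_{i,j}=\{v\in V_{i,j}: v=v^*\}$, and let $D_0$ be the C*-algebra generated by $\bigcup_{i,j}E_{i,j}$. The requirements are: 1. $B$ is generated as a C*-algebra by $A\cup D$; 2. $dd'=d'd$ for all $d\in D$ and $d'\in D_0$;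 3. $vdv^*\in D$ for all $d\in D$ and $v\in V$. -/

import Mathlib

noncomputable section

namespace AFAction

/-- The C*-subalgebra of `B` generated by a set `S` (not assumed to contain the unit). -/
def cstarGen {B : Type*} [CStarAlgebra B] (S : Set B) : NonUnitalStarSubalgebra ℂ B :=
  (NonUnitalStarAlgebra.adjoin ℂ S).topologicalClosure

/-- `B` is generated, as a C*-algebra, by one element. -/
def SinglyGenerated (B : Type*) [CStarAlgebra B] : Prop :=
  ∃ g : B, cstarGen {g} = ⊤

/-- A unital C*-algebra is simple: it is nonzero and its only closed two-sided ideals are the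
trivial ones. -/
def IsSimpleCStar (A : Type*) [NormedRing A] : Prop :=
  Nontrivial A ∧ ∀ I : TwoSidedIdeal A, IsClosed (I : Set A) → I = ⊥ ∨ I = ⊤

/-- An inductive sequence of finite-dimensional algebras `⨁ⱼ M_{n i j}(ℂ)` with canonical unital
connecting maps. The summand `j'` of stage `i` has multiplicity `m i j' j` in the summand `j` of
stage `i + 1`, and `L i j` records where on the diagonal of that summand the entries of the
various copies are placed. -/
structure CanonicalSequence where
  K : ℕ → ℕ
  n : (i : ℕ) → Fin (K i) → ℕ
  n_pos : ∀ i j, 0 < n i j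
  m : (i : ℕ) → Fin (K i) → Fin (K (i + 1)) → ℕ
  L : (i : ℕ) → (j : Fin (K (i + 1))) →
    ((c : (j' : Fin (K i)) × Fin (m i j' j)) × Fin (n i c.1)) ≃ Fin (n (i + 1) j)

namespace CanonicalSequence

variable (S : CanonicalSequence)

/-- The finite-dimensional algebra `⨁ⱼ M_{n i j}(ℂ)`. -/
abbrev Stage (i : ℕ) : Type :=
  (j : Fin (S.K i)) → Matrix (Fin (S.n i j)) (Fin (S.n i j)) ℂ

/-- The connecting map: the component of the image of `x` in the summand `j` is the block diagonal
matrix in which each `x j'` is repeated `m i j' j` times (after the permutation `L i j` of the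
standard basis). -/
def connect (i : ℕ) (x : S.Stage i) : S.Stage (i + 1) :=
  fun j => Matrix.reindex (S.L i j) (S.L i j)
    (Matrix.blockDiagonal' fun c : (j' : Fin (S.K i)) × Fin (S.m i j' j) => x c.1)

/-- The composite connecting map from stage `i` to stage `i + k`. -/
def connectIter (i : ℕ) : (k : ℕ) → S.Stage i → S.Stage (i + k)
  | 0, x => x
  | k + 1, x => S.connect (i + k) (connectIter i k x)

/-- The matrix unit `e_{a,b}` of the summand `j` of stage `i`. -/
def matrixUnit (i : ℕ) (j : Fin (S.K i)) (a b : Fin (S.n i j)) : S.Stage i :=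
  Pi.single j (Matrix.single a b 1)

end CanonicalSequence

/-- A realisation of the C*-subalgebra `A` of `B` (with the unit of `B`) as the inductive limit of
a canonical inductive sequence of finite-dimensional algebras; `ι i` is the canonical map of the
stage `i` into the limit. -/
structure CanonicalDecomposition {B : Type*} [CStarAlgebra B] (A : StarSubalgebra ℂ B) extends
    CanonicalSequence where
  ι : (i : ℕ) → toCanonicalSequence.Stage i →⋆ₐ[ℂ] B
  ι_connect : ∀ i x, ι (i + 1) (toCanonicalSequence.connect i x) = ι i x
  ι_eq_zero : ∀ i x, ι i x = 0 → ∃ k, toCanonicalSequence.connectIter i k x = 0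
  closure_range : closure (⋃ i, Set.range (ι i)) = (A : Set B)

namespace CanonicalDecomposition

variable {B : Type*} [CStarAlgebra B] {A : StarSubalgebra ℂ B} (C : CanonicalDecomposition A)

/-- The canonical matrix units of the summand `j` of stage `i`, as elements of `B`. -/
def unitsAt (i : ℕ) (j : Fin (C.K i)) : Set B :=
  {v | ∃ a b, v = C.ι i (C.toCanonicalSequence.matrixUnit i j a b)}

/-- The self-adjoint canonical matrix units of the summand `j` of stage `i`. -/
def projectionsAt (i : ℕ) (j : Fin (C.K i)) : Set B :=
  {v | v ∈ C.unitsAt i j ∧ v = star v}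

/-- The set of all canonical matrix units. -/
def units : Set B := ⋃ i, ⋃ j, C.unitsAt i j

/-- The diagonal subalgebra, generated by all the self-adjoint canonical matrix units. -/
def diagonal : NonUnitalStarSubalgebra ℂ B := cstarGen (⋃ i, ⋃ j, C.projectionsAt i j)

end CanonicalDecomposition

/-- `B` has an AF-action: it is generated by an infinite-dimensional simple separable unital AF
subalgebra `A` and a separable unital C*-subalgebra `D` such that, for some canonical
decomposition of `A`, `D` commutes with the diagonal subalgebra and is mapped into itself by
`d ↦ v d v*` for every canonical matrix unit `v`. -/
def HasAFAction (B : Type*) [CStarAlgebra B] : Prop :=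
  ∃ A D : StarSubalgebra ℂ B,
    IsClosed (A : Set B) ∧ IsSimpleCStar A ∧ ¬ FiniteDimensional ℂ A ∧
    TopologicalSpace.IsSeparable (A : Set B) ∧
    IsClosed (D : Set B) ∧ TopologicalSpace.IsSeparable (D : Set B) ∧
    ∃ C : CanonicalDecomposition A,
      cstarGen ((A : Set B) ∪ (D : Set B)) = ⊤ ∧
      (∀ d ∈ D, ∀ d' ∈ C.diagonal, d * d' = d' * d) ∧
      (∀ d ∈ D, ∀ v ∈ C.units, v * d * star v ∈ D)

end AFAction

end

open scoped CStarAlgebra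

/-! ### Single generators: commuting projections, weighted matrix units, and the unit. -/

section SingleGenerator

variable {B : Type*} [CStarAlgebra B]

/-! The limit is viewed as a refining sequence of finite systems of nonzero matrix units. Simplicity
and infinite dimension of A allow passing to a subsequence along which every minimal projection has
at least three subprojections in each summand of the next stage (`exists_refinement_card_children`).

The generator is g = a + ib with a, b self-adjoint. All diagonal projections commute, so one element
a yields them all (`exists_generator_of_commuting_projections`). The element b is a weighted sum
over slots, the pairs that become distinct and equivalent for the first time at their level. A
slot's corner meets no other level's terms, so compressing b by diagonal projections isolates each
term (`mul_sum_mul_eq_zero`). Slots suffice to recover all matrix units (`v_mem_of_slot`).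

To capture D as well, some slots carry h v instead of v, where h is a positive invertible element of
D. Since h commutes with e = v v*, a square root separates h e from v (`mem_of_mul_matrixUnit`).
Rotating at least three siblings cyclically gives every minimal projection e_s an oriented slot of
its own, so h = Σ h e_s is recovered. Countably many such h generate D, and D together with the
matrix units generates B. -/

/-- Take a = Σ 3⁻ᵏ q_k. Characters send each q_k to 0 or 1, so φ(a) is a Cantor-type sum determining
all φ(q_k), hence φ. Thus a separates characters, and Stone–Weierstrass applies. -/
theorem commCStar_exists_generator {Z : Type*} [CommCStarAlgebra Z] (q : ℕ → Z)
    (hq : ∀ k, IsStarProjection (q k))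
    (hZ : (StarAlgebra.adjoin ℂ (Set.range q)).topologicalClosure = ⊤) :
    ∃ a : Z, IsSelfAdjoint a ∧ StarAlgebra.elemental ℂ a = ⊤ := by
  have hn : ∀ k, ‖q k‖ ≤ 1 := fun k => (hq k).norm_le
  have hs : Summable fun k : ℕ => ((1 / 3 : ℝ) ^ k) • q k := by
    refine Summable.of_norm_bounded (summable_geometric_of_lt_one (r := (1 / 3 : ℝ))
      (by norm_num) (by norm_num)) fun k => ?_
    rw [norm_smul, norm_pow]
    have : ‖(1 / 3 : ℝ)‖ = 1 / 3 := by norm_num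
    rw [this]
    exact mul_le_of_le_one_right (by positivity) (hn k)
  set a : Z := ∑' k : ℕ, ((1 / 3 : ℝ) ^ k) • q k with ha
  refine ⟨a, ?_, ?_⟩
  · rw [IsSelfAdjoint, ha, tsum_star]
    refine tsum_congr fun k => ?_
    rw [star_smul, (hq k).isSelfAdjoint.star_eq, star_trivial]
  have hval : ∀ (φ : WeakDual.characterSpace ℂ Z) k, φ (q k) = 0 ∨ φ (q k) = 1 := by
    intro φ k
    have h : φ (q k) * φ (q k) = φ (q k) := by
      rw [← map_mul, (hq k).isIdempotentElem.eq]
    rcases eq_or_ne (φ (q k)) 0 with h0 | h0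
    · exact Or.inl h0
    · exact Or.inr (mul_left_cancel₀ h0 (by rw [h, mul_one]))
  classical
  -- Any ratio below 1/2 makes the digit sequence recoverable; 1/3 is one.
  have hφ : ∀ φ : WeakDual.characterSpace ℂ Z,
      φ a = (Cardinal.cantorFunction (1 / 3) fun k => decide (φ (q k) = 1) : ℝ) := by
    intro φ
    have h1 : φ a = ∑' k : ℕ, φ (((1 / 3 : ℝ) ^ k) • q k) :=
      ContinuousLinearMap.map_tsum (WeakDual.CharacterSpace.toCLM φ) hs
    rw [h1, Cardinal.cantorFunction, Complex.ofReal_tsum]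
    refine tsum_congr fun k => ?_
    have h2 : φ (((1 / 3 : ℝ) ^ k) • q k) = ((1 / 3 : ℝ) ^ k : ℝ) * φ (q k) := by
      rw [← Complex.coe_smul, map_smul, smul_eq_mul]
    rw [h2, Cardinal.cantorFunctionAux]
    rcases hval φ k with h | h <;> simp [h]
  have hsep : (StarAlgebra.adjoin ℂ {gelfandStarTransform Z a}).SeparatesPoints := by
    intro φ ψ hne
    refine ⟨_, ⟨gelfandStarTransform Z a, StarAlgebra.self_mem_adjoin_singleton ℂ _, rfl⟩, ?_⟩
    change φ a ≠ ψ a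
    rw [hφ, hφ]
    intro h
    have h' := Cardinal.cantorFunction_injective (by norm_num) (by norm_num)
      (Complex.ofReal_injective h)
    apply hne
    have hk : ∀ k, φ (q k) = ψ (q k) := by
      intro k
      have := congrFun h' k
      simp only [decide_eq_decide] at this
      rcases hval φ k with h1 | h1 <;> rcases hval ψ k with h2 | h2 <;> simp_all
    have hmem : ∀ z : Z, φ z = ψ z := by
      intro z
      have hz : z ∈ (StarAlgebra.adjoin ℂ (Set.range q)).topologicalClosure := by
        rw [hZ]; trivial
      let E : StarSubalgebra ℂ Z :=
        StarAlgHom.equalizer (φ : Z →⋆ₐ[ℂ] ℂ) (ψ : Z →⋆ₐ[ℂ] ℂ)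
      have hE : IsClosed (E : Set Z) := isClosed_eq (map_continuous φ) (map_continuous ψ)
      have := StarSubalgebra.topologicalClosure_minimal
        (show StarAlgebra.adjoin ℂ (Set.range q) ≤ E from
          StarAlgebra.adjoin_le (by rintro _ ⟨k, rfl⟩; exact hk k)) hE hz
      exact this
    ext z
    exact hmem z
  have htop := ContinuousMap.starSubalgebra_topologicalClosure_eq_top_of_separatesPoints _ hsep
  rw [eq_top_iff]
  intro z _
  let F : C(WeakDual.characterSpace ℂ Z, ℂ) ≃⋆ₐ[ℂ] Z := (gelfandStarTransform Z).symm
  have hF : Continuous F := map_continuous F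
  let S : StarSubalgebra ℂ C(WeakDual.characterSpace ℂ Z, ℂ) :=
    (StarAlgebra.elemental ℂ a).comap (F : C(WeakDual.characterSpace ℂ Z, ℂ) →⋆ₐ[ℂ] Z)
  have hS : IsClosed (S : Set C(WeakDual.characterSpace ℂ Z, ℂ)) :=
    (StarAlgebra.elemental.isClosed ℂ a).preimage hF
  have h1 : (StarAlgebra.adjoin ℂ {gelfandStarTransform Z a}).topologicalClosure ≤ S := by
    refine StarSubalgebra.topologicalClosure_minimal (StarAlgebra.adjoin_le ?_) hS
    rintro _ rfl
    change F (gelfandStarTransform Z a) ∈ StarAlgebra.elemental ℂ a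
    have : F (gelfandStarTransform Z a) = a := (gelfandStarTransform Z).symm_apply_apply a
    rw [this]
    exact StarAlgebra.elemental.self_mem ℂ a
  rw [htop] at h1
  have h2 : F (gelfandStarTransform Z z) ∈ StarAlgebra.elemental ℂ a :=
    h1 (x := gelfandStarTransform Z z) trivial
  have h3 : F (gelfandStarTransform Z z) = z := (gelfandStarTransform Z).symm_apply_apply z
  rwa [h3] at h2

theorem exists_generator_of_commuting_projections (q : ℕ → B)
    (hq : ∀ k, IsStarProjection (q k)) (hc : ∀ k l, q k * q l = q l * q k) :
    ∃ a : B, IsSelfAdjoint a ∧ ∀ k, q k ∈ StarAlgebra.elemental ℂ a := by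
  let Z : StarSubalgebra ℂ B := (StarAlgebra.adjoin ℂ (Set.range q)).topologicalClosure
  have hZ : IsClosed (Z : Set B) := StarSubalgebra.isClosed_topologicalClosure _
  have hcomm : ∀ x y : Z, x * y = y * x := by
    have hadj : ∀ x y : StarAlgebra.adjoin ℂ (Set.range q), x * y = y * x :=
      (StarAlgebra.isMulCommutative_adjoin ℂ
        (by rintro _ ⟨k, rfl⟩ _ ⟨l, rfl⟩; exact hc k l)
        (by
          rintro _ ⟨k, rfl⟩ _ ⟨l, rfl⟩
          rw [(hq l).isSelfAdjoint.star_eq]; exact hc k l)).is_comm.comm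
    exact (StarSubalgebra.commRingTopologicalClosure _ hadj).mul_comm
  let : CommCStarAlgebra Z :=
    { StarSubalgebra.cstarAlgebra Z (h_closed := hZ) with mul_comm := hcomm }
  let q' : ℕ → Z := fun k => ⟨q k, StarSubalgebra.le_topologicalClosure _
    (StarAlgebra.subset_adjoin ℂ _ ⟨k, rfl⟩)⟩
  have hq' : ∀ k, IsStarProjection (q' k) := fun k =>
    ⟨Subtype.ext (hq k).isIdempotentElem, Subtype.ext (hq k).isSelfAdjoint⟩
  obtain ⟨a, ha, htop⟩ := commCStar_exists_generator q' hq' (by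
    have hle : StarAlgebra.adjoin ℂ (Set.range q) ≤
        (StarAlgebra.adjoin ℂ (Set.range q')).map Z.subtype :=
      StarAlgebra.adjoin_le (by
        rintro _ ⟨k, rfl⟩
        exact ⟨q' k, StarAlgebra.subset_adjoin ℂ _ ⟨k, rfl⟩, rfl⟩)
    rw [eq_top_iff]
    intro z _
    change z ∈ closure (StarAlgebra.adjoin ℂ (Set.range q') : Set Z)
    rw [closure_subtype]
    exact closure_mono (fun y hy => hle hy) z.2)
  refine ⟨a, congrArg Subtype.val ha, fun k => ?_⟩
  let S : StarSubalgebra ℂ Z := (StarAlgebra.elemental ℂ (a : B)).comap Z.subtype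
  have hS : IsClosed (S : Set Z) :=
    (StarAlgebra.elemental.isClosed ℂ (a : B)).preimage continuous_subtype_val
  have hle : StarAlgebra.elemental ℂ a ≤ S :=
    StarAlgebra.elemental.le_of_mem hS (StarAlgebra.elemental.self_mem ℂ (a : B))
  rw [htop] at hle
  exact hle (x := q' k) trivial

/-- Because h commutes with e = v v*, (h v)(h v)* = (h e)², whose positive square root is h e.
Adding 1 - e makes it invertible, and the inverse strips h from h v. -/
theorem mem_of_mul_matrixUnit [PartialOrder B] [StarOrderedRing B] {C : StarSubalgebra ℂ B} (hC : IsClosed (C : Set B))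
    {h e v : B} (hh : 0 ≤ h) (hu : IsUnit h) (he : IsStarProjection e) (hcomm : h * e = e * h)
    (hv : v * star v = e) (hev : e * v = v) (heC : e ∈ C) (hx : h * v ∈ C) :
    h * e ∈ C ∧ v ∈ C := by
  have hsa : star h = h := (IsSelfAdjoint.of_nonneg hh).star_eq
  have hnn : 0 ≤ h * e := by
    have : h * e = star e * h * e := by
      rw [he.isSelfAdjoint.star_eq, ← hcomm, mul_assoc, he.isIdempotentElem.eq]
    rw [this]
    exact star_left_conjugate_nonneg hh e
  have hsq : (h * e) * (h * e) = (h * v) * star (h * v) := by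
    rw [star_mul, hsa]
    calc h * e * (h * e) = h * (e * h) * e := by noncomm_ring
      _ = h * h * (e * e) := by rw [← hcomm]; noncomm_ring
      _ = h * (e * h) := by rw [he.isIdempotentElem.eq, ← hcomm, mul_assoc]
      _ = h * v * (star v * h) := by rw [← hv]; noncomm_ring
  have hhe : h * e ∈ C := by
    have h1 : CFC.sqrt ((h * v) * star (h * v)) = h * e := CFC.sqrt_unique hsq hnn
    rw [← h1, CFC.sqrt_eq_real_sqrt _ (mul_star_self_nonneg _)]
    have := hC
    exact cfcₙ_mem (𝕜' := ℂ) (s := C) _ (mul_mem hx (star_mem hx))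
  refine ⟨hhe, ?_⟩
  have hz : h * e + (1 - e) ∈ C := add_mem hhe (sub_mem (one_mem C) heC)
  have hzu : IsUnit (h * e + (1 - e)) := by
    obtain ⟨y, hy1, hy2⟩ := isUnit_iff_exists.1 hu
    have hye : y * e = e * y := by
      calc y * e = y * e * (h * y) := by rw [hy1, mul_one]
        _ = y * (e * h) * y := by noncomm_ring
        _ = (y * h) * e * y := by rw [← hcomm]; noncomm_ring
        _ = e * y := by rw [hy2, one_mul]
    have hee := he.isIdempotentElem.eq
    have key : ∀ h y : B, h * y = 1 → y * e = e * y →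
        (h * e + (1 - e)) * (y * e + (1 - e)) = 1 := by
      intro h y hy hye
      calc (h * e + (1 - e)) * (y * e + (1 - e))
          = h * (e * y) * e + (h * e - h * (e * e)) + (y * e - (e * y) * e)
            + (1 - e - e + e * e) := by noncomm_ring
        _ = 1 := by
          rw [← hye, mul_assoc h, mul_assoc y, hee, ← mul_assoc, hy]; noncomm_ring
    exact isUnit_iff_exists.2 ⟨y * e + (1 - e), key h y hy1 hye, key y h hy2 hcomm⟩
  have := hC
  -- Spectral permanence: an inverse in B of an element of a closed unital star subalgebra lies in
  -- that subalgebra.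
  have hzu' : IsUnit (⟨_, hz⟩ : C) := by
    rwa [← StarSubalgebra.coe_isUnit]
  obtain ⟨⟨y, hyC⟩, -, hy⟩ := isUnit_iff_exists.1 hzu'
  have hy : y * (h * e + (1 - e)) = 1 := congrArg Subtype.val hy
  have h2 : y * (h * v) = v := by
    calc y * (h * v) = y * (h * e + (1 - e)) * v := by
          rw [mul_assoc, add_mul, sub_mul, one_mul, mul_assoc h, hev, sub_self, add_zero]
      _ = v := by rw [hy, one_mul]
  rw [← h2]
  exact mul_mem hyC hx

/-- `elemental` includes the unit for free, while `cstarGen` does not. Replacing g by u = 1 + c g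
with c g of norm below 1 lets the non-unital algebra find the unit, as the limit of 1 - (1 - u)ⁿ. -/
theorem singlyGenerated_of_elemental_eq_top (g : B) (hg : StarAlgebra.elemental ℂ g = ⊤) :
    AFAction.SinglyGenerated B := by
  obtain ⟨c, hc, hc1⟩ : ∃ c : ℝ, 0 < c ∧ c * ‖g‖ < 1 :=
    ⟨1 / (‖g‖ + 1), by positivity, by
      rw [one_div, inv_mul_lt_iff₀ (by positivity)]; linarith⟩
  refine ⟨1 + (c : ℂ) • g, ?_⟩
  set u := 1 + (c : ℂ) • g with hu
  have hnorm : ‖1 - u‖ < 1 := by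
    rw [hu, sub_add_cancel_left, norm_neg, norm_smul, Complex.norm_real, Real.norm_of_nonneg hc.le]
    exact hc1
  set N := AFAction.cstarGen {u} with hN
  have hNc : IsClosed (N : Set B) := NonUnitalStarSubalgebra.isClosed_topologicalClosure _
  have huN : u ∈ N := NonUnitalStarSubalgebra.le_topologicalClosure _
    (NonUnitalStarAlgebra.subset_adjoin ℂ _ rfl)
  have h1N : (1 : B) ∈ N := by
    have hmem : ∀ n : ℕ, 1 - (1 - u) ^ n ∈ N := by
      intro n
      induction n with
      | zero => simp
      | succ n ih =>
        have : 1 - (1 - u) ^ (n + 1) = (1 - (1 - u) ^ n) + u - (1 - (1 - u) ^ n) * u := by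
          rw [pow_succ]; noncomm_ring
        rw [this]
        exact sub_mem (add_mem ih huN) (mul_mem ih huN)
    have hlim : Filter.Tendsto (fun n : ℕ => 1 - (1 - u) ^ n) Filter.atTop (nhds (1 - 0)) :=
      tendsto_const_nhds.sub (tendsto_pow_atTop_nhds_zero_of_norm_lt_one hnorm)
    rw [sub_zero] at hlim
    exact hNc.mem_of_tendsto hlim (Filter.Eventually.of_forall hmem)
  let S : StarSubalgebra ℂ B :=
    { N with
      one_mem' := h1N
      algebraMap_mem' := fun r => by
        rw [Algebra.algebraMap_eq_smul_one]; exact N.smul_mem r h1N }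
  have hgS : g ∈ S := by
    have : g = (c : ℂ)⁻¹ • (u - 1) := by
      rw [hu, add_sub_cancel_left, inv_smul_smul₀]
      exact_mod_cast hc.ne'
    rw [this]
    exact S.smul_mem (sub_mem (show u ∈ S from huN) (one_mem S)) _
  have hS : StarAlgebra.elemental ℂ g ≤ S := StarAlgebra.elemental.le_of_mem (S := S) hNc hgS
  rw [hg] at hS
  rw [eq_top_iff]
  intro x _
  exact hS (x := x) trivial

end SingleGenerator

/-! ### Matrix unit systems and their refinements. -/

/-- A system of nonzero matrix units of a finite-dimensional unital C*-subalgebra of `B`, indexed by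
the minimal diagonal projections; `kind` tells the simple summands apart. -/
structure MatrixUnitSystem (B : Type*) [CStarAlgebra B] where
  X : Type
  [fintypeX : Fintype X]
  [decEqX : DecidableEq X]
  kind : X → ℕ
  v : X → X → B
  star_v : ∀ s t, star (v s t) = v t s
  v_mul_v : ∀ s t u, kind s = kind t → kind t = kind u → v s t * v t u = v s u
  v_mul_v_of_ne : ∀ s t t' u, t ≠ t' → v s t * v t' u = 0
  v_eq_zero : ∀ s t, kind s ≠ kind t → v s t = 0
  sum_v : ∑ s, v s s = 1
  v_self_ne_zero : ∀ s, v s s ≠ 0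

attribute [instance] MatrixUnitSystem.fintypeX MatrixUnitSystem.decEqX

namespace MatrixUnitSystem

variable {B : Type*} [CStarAlgebra B] (U V W : MatrixUnitSystem B)

/-- The minimal diagonal projections. -/
def e (s : U.X) : B := U.v s s

theorem e_mul_v (s t : U.X) : U.e s * U.v s t = U.v s t := by
  by_cases h : U.kind s = U.kind t
  · exact U.v_mul_v s s t rfl h
  · rw [U.v_eq_zero s t h, mul_zero]

theorem v_mul_e (s t : U.X) : U.v s t * U.e t = U.v s t := by
  by_cases h : U.kind s = U.kind t
  · exact U.v_mul_v s t t h rfl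
  · rw [U.v_eq_zero s t h, zero_mul]

theorem e_mul_v_of_ne {r s : U.X} (h : r ≠ s) (t : U.X) : U.e r * U.v s t = 0 :=
  U.v_mul_v_of_ne _ _ _ _ h

theorem v_mul_e_of_ne {t u : U.X} (s : U.X) (h : t ≠ u) : U.v s t * U.e u = 0 :=
  U.v_mul_v_of_ne _ _ _ _ h

theorem e_mul_e_self (s : U.X) : U.e s * U.e s = U.e s := U.e_mul_v s s

theorem e_mul_e_of_ne {s t : U.X} (h : s ≠ t) : U.e s * U.e t = 0 := U.e_mul_v_of_ne h t

theorem star_e (s : U.X) : star (U.e s) = U.e s := U.star_v s s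

theorem isStarProjection_e (s : U.X) : IsStarProjection (U.e s) :=
  ⟨U.e_mul_e_self s, U.star_e s⟩

theorem v_mul_star_v {s t : U.X} (h : U.kind s = U.kind t) :
    U.v s t * star (U.v s t) = U.e s := by
  rw [U.star_v]; exact U.v_mul_v s t s h h.symm

theorem v_ne_zero {s t : U.X} (h : U.kind s = U.kind t) : U.v s t ≠ 0 := by
  intro h0
  apply U.v_self_ne_zero s
  have := U.v_mul_star_v h
  rw [h0, zero_mul] at this
  exact this.symm

theorem nonempty_X [Nontrivial B] : Nonempty U.X := by
  by_contra h
  rw [not_nonempty_iff] at h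
  have := U.sum_v
  simp at this

/-- The finer system `V` refines `U`: every minimal projection of `V` lies under its parent, and the
matrix units of `U` move children of one projection to children of the other. -/
structure Refinement (U V : MatrixUnitSystem B) where
  p : V.X → U.X
  e_mul_e : ∀ s, V.e s * U.e (p s) = V.e s
  exists_translate : ∀ x y s, U.kind x = U.kind y → p s = x →
    ∃ s', p s' = y ∧ V.kind s = V.kind s' ∧ V.e s * U.v x y = V.v s s'

namespace Refinement

variable {U V W}

/-- Every system refines itself. -/
def refl (U : MatrixUnitSystem B) : Refinement U U where
  p := id
  e_mul_e := U.e_mul_e_self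
  exists_translate := by
    rintro x y s h rfl
    exact ⟨y, rfl, h, U.e_mul_v s y⟩

/-- Composition of refinements. -/
def comp (r : Refinement U V) (r' : Refinement V W) : Refinement U W where
  p := r.p ∘ r'.p
  e_mul_e s := by
    rw [← r'.e_mul_e s, mul_assoc]
    exact congrArg _ (r.e_mul_e _)
  exists_translate := by
    intro x y s h hs
    obtain ⟨s', h1, h2, h3⟩ := r.exists_translate x y (r'.p s) h hs
    obtain ⟨u, h4, h5, h6⟩ := r'.exists_translate (r'.p s) s' s h2 rfl
    refine ⟨u, by rw [Function.comp_apply, h4, h1], h5, ?_⟩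
    rw [← h6, ← h3, ← mul_assoc, r'.e_mul_e]

variable (r : Refinement U V)

theorem e_mul_e_of_ne {s : V.X} {x : U.X} (h : r.p s ≠ x) : V.e s * U.e x = 0 := by
  rw [← r.e_mul_e, mul_assoc, U.e_mul_e_of_ne h, mul_zero]

theorem e_mul_e_of_eq {s : V.X} {x : U.X} (h : r.p s = x) : V.e s * U.e x = V.e s := by
  rw [← h, r.e_mul_e]

theorem e_mul_e_of_ne' {s : V.X} {x : U.X} (h : r.p s ≠ x) : U.e x * V.e s = 0 := by
  have := congrArg star (r.e_mul_e_of_ne h)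
  rwa [star_mul, U.star_e, V.star_e, star_zero] at this

/-- Inserting 1 = Σ e_s on the left leaves only children s of x, and each such term is a translate
inside V. -/
theorem v_mem_span (r : Refinement U V) (x y : U.X) :
    U.v x y ∈ Submodule.span ℂ (Set.range fun z : V.X × V.X => V.v z.1 z.2) := by
  by_cases h : U.kind x = U.kind y
  swap
  · rw [U.v_eq_zero x y h]; exact zero_mem _
  rw [← one_mul (U.v x y), ← V.sum_v, Finset.sum_mul]
  refine sum_mem fun s _ => ?_
  change V.e s * U.v x y ∈ _
  by_cases hs : r.p s = x
  · obtain ⟨s', -, -, h3⟩ := r.exists_translate x y s h hs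
    rw [h3]
    exact Submodule.subset_span ⟨(s, s'), rfl⟩
  · rw [← U.e_mul_v, ← mul_assoc, r.e_mul_e_of_ne hs, zero_mul]
    exact zero_mem _

end Refinement

/-- The linear span of the matrix units. -/
noncomputable def linSpan : Submodule ℂ B := Submodule.span ℂ (Set.range fun z : U.X × U.X => U.v z.1 z.2)

theorem v_mem (s t : U.X) : U.v s t ∈ U.linSpan := Submodule.subset_span ⟨(s, t), rfl⟩

variable {U V} in
theorem Refinement.linSpan_le (r : Refinement U V) : U.linSpan ≤ V.linSpan := by
  rw [linSpan, Submodule.span_le]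
  rintro _ ⟨⟨x, y⟩, rfl⟩
  exact r.v_mem_span x y

end MatrixUnitSystem

/-! ### Encoding D and the matrix units in one element. -/

/-- A self-adjoint z is (‖z‖ + 1 + z) minus a scalar, with ‖z‖ + 1 + z ≥ 1, so positive invertibles
generate D. Separability supplies a countable dense set of them. -/
theorem exists_seq_nonneg_units_generating {B : Type*} [CStarAlgebra B] [PartialOrder B]
    [StarOrderedRing B] (D : StarSubalgebra ℂ B)
    (hD : TopologicalSpace.IsSeparable (D : Set B)) :
    ∃ h : ℕ → B, (∀ n, h n ∈ D ∧ 0 ≤ h n ∧ IsUnit (h n)) ∧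
      ∀ C : StarSubalgebra ℂ B, IsClosed (C : Set B) → (∀ n, h n ∈ C) → D ≤ C := by
  let H : Set B := {h | h ∈ D ∧ 0 ≤ h ∧ IsUnit h}
  have hH : TopologicalSpace.IsSeparable H := hD.mono fun h hh => hh.1
  obtain ⟨t, htH, htc, hHt⟩ := hH.exists_countable_dense_subset
  have h1 : (1 : B) ∈ H := ⟨one_mem D, zero_le_one' B, isUnit_one⟩
  have htn : t.Nonempty := closure_nonempty_iff.1 ⟨1, hHt h1⟩
  obtain ⟨h, rfl⟩ := htc.exists_eq_range htn
  refine ⟨h, fun n => htH ⟨n, rfl⟩, fun C hC hh => ?_⟩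
  have hHC : H ⊆ C := hHt.trans (hC.closure_subset_iff.2 (by rintro _ ⟨n, rfl⟩; exact hh n))
  have hsa : ∀ z ∈ D, IsSelfAdjoint z → z ∈ C := by
    intro z hz hzs
    have hle := hzs.neg_algebraMap_norm_le_self
    have h2 : algebraMap ℝ B ‖z‖ + 1 + z ∈ H := by
      have hle1 : (1 : B) ≤ algebraMap ℝ B ‖z‖ + 1 + z := by
        have : 0 ≤ z - -(algebraMap ℝ B ‖z‖) := sub_nonneg.2 hle
        calc (1 : B) ≤ 1 + (z - -(algebraMap ℝ B ‖z‖)) := le_add_of_nonneg_right this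
          _ = _ := by abel
      refine ⟨add_mem (add_mem ?_ (one_mem D)) hz, (zero_le_one' B).trans hle1,
        CStarAlgebra.isUnit_of_le 1 hle1⟩
      rw [IsScalarTower.algebraMap_apply ℝ ℂ B]
      exact algebraMap_mem D _
    have h3 : z = (algebraMap ℝ B ‖z‖ + 1 + z) - algebraMap ℂ B ‖z‖ - 1 := by
      rw [IsScalarTower.algebraMap_apply ℝ ℂ B]
      simp only [Complex.coe_algebraMap]
      abel
    rw [h3]
    exact sub_mem (sub_mem (hHC h2) (algebraMap_mem C _)) (one_mem C)
  intro z hz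
  have ha : z + star z ∈ C := hsa _ (add_mem hz (star_mem hz)) (IsSelfAdjoint.add_star_self z)
  have hb : Complex.I • (z - star z) ∈ C := by
    refine hsa _ (D.smul_mem (sub_mem hz (star_mem hz)) _) ?_
    rw [IsSelfAdjoint, star_smul, star_sub, star_star, Complex.star_def, Complex.conj_I, neg_smul,
      ← smul_neg, neg_sub]
  have hzz : z = (2⁻¹ : ℂ) • ((z + star z) - Complex.I • (Complex.I • (z - star z))) := by
    rw [smul_smul, Complex.I_mul_I, neg_one_smul, sub_neg_eq_add, add_add_sub_cancel,
      ← two_smul ℂ z, smul_smul, inv_mul_cancel₀ two_ne_zero, one_smul]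
  rw [hzz]
  exact C.smul_mem (sub_mem ha (C.smul_mem hb _)) _

namespace MatrixUnitSystem

variable {B : Type*} [CStarAlgebra B] {W : ℕ → MatrixUnitSystem B}
  (r : ∀ m, Refinement (W m) (W (m + 1)))

/-- No two ancestors of `s` and `t` at a strictly earlier level are distinct and of the same
kind. -/
def Fresh : ∀ m, (W m).X → (W m).X → Prop
  | 0, _, _ => True
  | m + 1, s, t => Fresh m ((r m).p s) ((r m).p t) ∧
      ¬((r m).p s ≠ (r m).p t ∧ (W m).kind ((r m).p s) = (W m).kind ((r m).p t))

/-- The pairs which become distinct and of the same kind at level `m` for the first time. -/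
def Slot (m : ℕ) (s t : (W m).X) : Prop :=
  Fresh r m s t ∧ s ≠ t ∧ (W m).kind s = (W m).kind t

/-- The refinement of the level `l` by the level `l + j`. -/
noncomputable def iterRefinement (l : ℕ) : ∀ j, Refinement (W l) (W (l + j))
  | 0 => Refinement.refl _
  | j + 1 => (iterRefinement l j).comp (r (l + j))

theorem fresh_self (m : ℕ) (s : (W m).X) : Fresh r m s s := by
  induction m with
  | zero => trivial
  | succ m ih => exact ⟨ih _, fun h => h.1 rfl⟩

theorem Fresh.symm {m : ℕ} {s t : (W m).X} (h : Fresh r m s t) : Fresh r m t s := by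
  induction m with
  | zero => trivial
  | succ m ih => exact ⟨ih h.1, fun h' => h.2 ⟨h'.1.symm, h'.2.symm⟩⟩

theorem Slot.symm {m : ℕ} {s t : (W m).X} (h : Slot r m s t) : Slot r m t s :=
  ⟨h.1.symm, h.2.1.symm, h.2.2.symm⟩

theorem Fresh.not_slot_ancestors (l j : ℕ) (s t : (W (l + (j + 1))).X)
    (h : Fresh r (l + (j + 1)) s t) :
    ¬Slot r l ((iterRefinement r l (j + 1)).p s) ((iterRefinement r l (j + 1)).p t) := by
  induction j with
  | zero => exact fun h' => h.2 h'.2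
  | succ j ih => exact ih _ _ h.1

variable {r}

/-- A surviving term would make the coarser of the two slots the pair of ancestors of the finer one,
which freshness forbids. -/
theorem mul_sum_mul_eq_zero {l m : ℕ} (hlm : l ≠ m) {s t : (W m).X} (h : Slot r m s t)
    {w : (W l).X → (W l).X → B} (hw : ∀ x y, w x y = (W l).e x * w x y * (W l).e y)
    (hw0 : ∀ x y, ¬Slot r l x y → w x y = 0) :
    (W m).e s * (∑ x, ∑ y, w x y) * (W m).e t = 0 := by
  rw [Finset.mul_sum, Finset.sum_mul]
  refine Finset.sum_eq_zero fun x _ => ?_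
  rw [Finset.mul_sum, Finset.sum_mul]
  refine Finset.sum_eq_zero fun y _ => ?_
  by_cases hxy : Slot r l x y
  swap
  · rw [hw0 x y hxy, mul_zero, zero_mul]
  have hassoc : (W m).e s * w x y * (W m).e t =
      ((W m).e s * (W l).e x) * w x y * ((W l).e y * (W m).e t) := by
    conv_lhs => rw [hw x y]
    noncomm_ring
  rw [hassoc]
  rcases lt_or_gt_of_ne hlm with hlt | hlt
  · obtain ⟨j, rfl⟩ : ∃ j, m = l + (j + 1) := Nat.exists_eq_add_of_lt hlt
    set R := iterRefinement r l (j + 1) with hR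
    by_cases hx : R.p s = x
    · by_cases hy : R.p t = y
      · subst hx hy
        exact absurd hxy (h.1.not_slot_ancestors r l j s t)
      · rw [R.e_mul_e_of_ne' hy, mul_zero]
    · rw [R.e_mul_e_of_ne hx, zero_mul, zero_mul]
  · obtain ⟨j, rfl⟩ : ∃ j, l = m + (j + 1) := Nat.exists_eq_add_of_lt hlt
    set R := iterRefinement r m (j + 1) with hR
    by_cases hx : R.p x = s
    · by_cases hy : R.p y = t
      · subst hx hy
        exact absurd h (hxy.1.not_slot_ancestors r m j x y)
      · rw [R.e_mul_e_of_ne hy, mul_zero]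
    · rw [R.e_mul_e_of_ne' hx, zero_mul, zero_mul]

theorem mul_sum_mul_eq {m : ℕ} (s t : (W m).X)
    {w : (W m).X → (W m).X → B} (hw : ∀ x y, w x y = (W m).e x * w x y * (W m).e y) :
    (W m).e s * (∑ x, ∑ y, w x y) * (W m).e t = w s t := by
  have key : ∀ x y, (W m).e s * w x y * (W m).e t =
      ((W m).e s * (W m).e x) * w x y * ((W m).e y * (W m).e t) := by
    intro x y
    conv_lhs => rw [hw x y]
    noncomm_ring
  rw [Finset.mul_sum, Finset.sum_mul, Finset.sum_eq_single s, Finset.mul_sum, Finset.sum_mul,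
    Finset.sum_eq_single t]
  · exact (hw s t).symm
  · intro y _ hy
    rw [key, (W m).e_mul_e_of_ne hy, mul_zero]
  · simp
  · intro x _ hx
    rw [Finset.mul_sum, Finset.sum_mul]
    refine Finset.sum_eq_zero fun y _ => ?_
    rw [key, (W m).e_mul_e_of_ne hx.symm, zero_mul, zero_mul]
  · simp

/-- Starting from x, one moves towards y level by level: when the current position and the ancestor
of y first become distinct and equivalent, their pair is a slot, and one jumps to that ancestor.
Descending a level carries the position to a translated child. If s and t have the same kind, the
walk ends at t. -/
theorem v_mem_of_slot {C : StarSubalgebra ℂ B} (he : ∀ m s, (W m).e s ∈ C)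
    (hs : ∀ m s t, Slot r m s t → (W m).v s t ∈ C) (m : ℕ) (s t : (W m).X) :
    (W m).v s t ∈ C := by
  have key : ∀ m, ∀ x y : (W m).X, ∃ x', (W m).kind x = (W m).kind x' ∧ (W m).v x x' ∈ C ∧
      Fresh r m x' y ∧ ¬(x' ≠ y ∧ (W m).kind x' = (W m).kind y) := by
    have step : ∀ m, ∀ x y x' : (W m).X, (W m).kind x = (W m).kind x' → (W m).v x x' ∈ C →
        Fresh r m x' y → ∃ x', (W m).kind x = (W m).kind x' ∧ (W m).v x x' ∈ C ∧
          Fresh r m x' y ∧ ¬(x' ≠ y ∧ (W m).kind x' = (W m).kind y) := by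
      intro m x y x' h1 h2 h3
      by_cases h4 : x' ≠ y ∧ (W m).kind x' = (W m).kind y
      · refine ⟨y, h1.trans h4.2, ?_, fresh_self r m y, fun h => h.1 rfl⟩
        rw [← (W m).v_mul_v x x' y h1 h4.2]
        exact mul_mem h2 (hs m x' y ⟨h3, h4⟩)
      · exact ⟨x', h1, h2, h3, h4⟩
    intro m
    induction m with
    | zero => exact fun x y => step 0 x y x rfl (he 0 x) trivial
    | succ m ih =>
      intro x y
      obtain ⟨z, h1, h2, h3⟩ := ih ((r m).p x) ((r m).p y)
      obtain ⟨x', h4, h5, h6⟩ := (r m).exists_translate _ z x h1 rfl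
      refine step (m + 1) x y x' h5 ?_ ?_
      · rw [← h6]
        exact mul_mem (he _ _) h2
      · rw [← h4] at h3
        exact h3
  by_cases hk : (W m).kind s = (W m).kind t
  · obtain ⟨s', h1, h2, -, h4⟩ := key m s t
    have : s' = t := by
      by_contra hne
      exact h4 ⟨hne, h1.symm.trans hk⟩
    rwa [this] at h2
  · rw [(W m).v_eq_zero s t hk]
    exact zero_mem C

theorem exists_smul_sum_slots (w : ∀ m, (W m).X → (W m).X → B)
    (hw : ∀ m x y, w m x y = (W m).e x * w m x y * (W m).e y)
    (hw0 : ∀ m x y, ¬Slot r m x y → w m x y = 0) (hstar : ∀ m x y, star (w m x y) = w m y x) :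
    ∃ b : B, IsSelfAdjoint b ∧ ∀ m s t, Slot r m s t →
      ∃ c : ℂ, c ≠ 0 ∧ (W m).e s * b * (W m).e t = c • w m s t := by
  set β : ℕ → B := fun m => ∑ x, ∑ y, w m x y with hβ
  have hβs : ∀ m, star (β m) = β m := by
    intro m
    simp only [hβ, star_sum, hstar]
    exact Finset.sum_comm
  -- Only positivity and summability matter; the scalars are divided out after compression.
  set c : ℕ → ℝ := fun m => (1 / 2) ^ m / (1 + ‖β m‖) with hc
  have hcpos : ∀ m, 0 < c m := fun m => by positivity
  have hsum : Summable fun m => c m • β m := by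
    refine Summable.of_norm_bounded (summable_geometric_of_lt_one (r := (1 / 2 : ℝ))
      (by norm_num) (by norm_num)) fun m => ?_
    rw [norm_smul, Real.norm_of_nonneg (hcpos m).le, hc, div_mul_eq_mul_div,
      div_le_iff₀ (by positivity)]
    gcongr
    linarith
  refine ⟨∑' m, c m • β m, ?_, fun m s t hst => ⟨(c m : ℂ), by exact_mod_cast (hcpos m).ne', ?_⟩⟩
  · rw [IsSelfAdjoint, tsum_star]
    exact tsum_congr fun m => by rw [star_smul, hβs, star_trivial]
  · rw [← hsum.tsum_mul_left, ← (hsum.mul_left _).tsum_mul_right, tsum_eq_single m]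
    · rw [mul_smul_comm, smul_mul_assoc, mul_sum_mul_eq s t (hw m), Complex.coe_smul]
    · intro l hl
      rw [mul_smul_comm, smul_mul_assoc, mul_sum_mul_eq_zero hl hst (hw l) (hw0 l), smul_zero]

theorem exists_isSelfAdjoint_e_mem [Nontrivial B]
    (hcomm : ∀ l m (s : (W l).X) (t : (W m).X), (W l).e s * (W m).e t = (W m).e t * (W l).e s) :
    ∃ a : B, IsSelfAdjoint a ∧ ∀ m s, (W m).e s ∈ StarAlgebra.elemental ℂ a := by
  have : Nonempty (Σ m, (W m).X) := ⟨0, (W 0).nonempty_X.some⟩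
  obtain ⟨f, hf⟩ := exists_surjective_nat (Σ m, (W m).X)
  obtain ⟨a, ha, h⟩ := exists_generator_of_commuting_projections
    (fun n => (W (f n).1).e (f n).2) (fun n => (W (f n).1).isStarProjection_e _)
    (fun k l => hcomm _ _ _ _)
  refine ⟨a, ha, fun m s => ?_⟩
  obtain ⟨n, hn⟩ := hf ⟨m, s⟩
  have := h n
  rwa [hn] at this

theorem mem_elemental_add_I_smul {a b : B} (ha : IsSelfAdjoint a) (hb : IsSelfAdjoint b) :
    a ∈ StarAlgebra.elemental ℂ (a + Complex.I • b) ∧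
      b ∈ StarAlgebra.elemental ℂ (a + Complex.I • b) := by
  set C := StarAlgebra.elemental ℂ (a + Complex.I • b)
  have hg : a + Complex.I • b ∈ C := StarAlgebra.elemental.self_mem ℂ _
  have hsg : star (a + Complex.I • b) = a - Complex.I • b := by
    rw [star_add, star_smul, ha.star_eq, hb.star_eq, Complex.star_def, Complex.conj_I, neg_smul,
      sub_eq_add_neg]
  have hg' := star_mem hg
  rw [hsg] at hg'
  have haC : a ∈ C := by
    have h : a = (2⁻¹ : ℂ) • ((a + Complex.I • b) + (a - Complex.I • b)) := by
      rw [add_add_sub_cancel, ← two_smul ℂ a, smul_smul, inv_mul_cancel₀ two_ne_zero, one_smul]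
    rw [h]
    exact C.smul_mem (add_mem hg hg') _
  refine ⟨haC, ?_⟩
  have h : b = (-Complex.I) • ((a + Complex.I • b) - a) := by
    rw [add_sub_cancel_left, smul_smul, neg_mul, Complex.I_mul_I, neg_neg, one_smul]
  rw [h]
  exact C.smul_mem (sub_mem hg haC) _

theorem exists_elemental_eq_top [Nontrivial B] (D : StarSubalgebra ℂ B)
    (hD : TopologicalSpace.IsSeparable (D : Set B))
    (hcomm : ∀ d ∈ D, ∀ m s, d * (W m).e s = (W m).e s * d) (heD : ∀ m s, (W m).e s ∈ D)
    (O : ∀ m, (W m).X → (W m).X → Prop) (hO : ∀ m s t, O m s t → ¬O m t s)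
    (hslot : ∀ m (s : (W (m + 1)).X), ∃ t, Slot r (m + 1) s t ∧ O (m + 1) s t)
    (hgen : ∀ C : StarSubalgebra ℂ B, IsClosed (C : Set B) → D ≤ C →
      (∀ m s t, (W m).v s t ∈ C) → C = ⊤) :
    ∃ g : B, StarAlgebra.elemental ℂ g = ⊤ := by
  classical
  let := CStarAlgebra.spectralOrder B
  have := CStarAlgebra.spectralOrderedRing B
  obtain ⟨h, hh, hhgen⟩ := exists_seq_nonneg_units_generating D hD
  set k : ℕ → B := fun m => h (m - 1) with hk
  have hks : ∀ m, star (k m) = k m := fun m => (IsSelfAdjoint.of_nonneg (hh _).2.1).star_eq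
  have hke : ∀ m s, k m * (W m).e s = (W m).e s * k m := fun m s => hcomm _ (hh _).1 m s
  -- The orientation O decides which end of a slot carries the weight. The opposite entry is the
  -- adjoint, so O must be asymmetric for b to be self-adjoint.
  let w : ∀ m, (W m).X → (W m).X → B := fun m s t =>
    if Slot r m s t then
      if O m s t then k m * (W m).v s t else if O m t s then (W m).v s t * k m else (W m).v s t
    else 0
  have hw0 : ∀ m x y, ¬Slot r m x y → w m x y = 0 := fun m x y hxy => if_neg hxy
  have hstar : ∀ m x y, star (w m x y) = w m y x := by
    intro m x y
    by_cases hs : Slot r m x y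
    · simp only [w, if_pos hs, if_pos hs.symm]
      by_cases h1 : O m x y
      · rw [if_pos h1, if_neg (hO m x y h1), if_pos h1, star_mul, hks, (W m).star_v]
      · by_cases h2 : O m y x
        · rw [if_neg h1, if_pos h2, if_pos h2, star_mul, hks, (W m).star_v]
        · rw [if_neg h1, if_neg h2, if_neg h2, if_neg h1, (W m).star_v]
    · rw [hw0 m x y hs, hw0 m y x (fun h => hs h.symm), star_zero]
  have hw : ∀ m x y, w m x y = (W m).e x * w m x y * (W m).e y := by
    intro m x y
    simp only [w]
    split_ifs
    · rw [← mul_assoc, ← hke, mul_assoc, mul_assoc, (W m).v_mul_e, (W m).e_mul_v]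
    · rw [mul_assoc, mul_assoc, hke, ← mul_assoc ((W m).v x y), (W m).v_mul_e, ← mul_assoc,
        (W m).e_mul_v]
    · rw [(W m).e_mul_v, (W m).v_mul_e]
    · rw [mul_zero, zero_mul]
  obtain ⟨a, ha, haE⟩ := exists_isSelfAdjoint_e_mem (W := W)
    (fun l m s t => hcomm _ (heD l s) m t)
  obtain ⟨b, hb, hbw⟩ := exists_smul_sum_slots (r := r) w hw hw0 hstar
  obtain ⟨haC, hbC⟩ := mem_elemental_add_I_smul ha hb
  refine ⟨a + Complex.I • b, ?_⟩
  set C := StarAlgebra.elemental ℂ (a + Complex.I • b)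
  have hC : IsClosed (C : Set B) := StarAlgebra.elemental.isClosed ℂ _
  have heC : ∀ m s, (W m).e s ∈ C := fun m s =>
    StarAlgebra.elemental.le_of_mem hC haC (haE m s)
  have hwC : ∀ m s t, Slot r m s t → w m s t ∈ C := by
    intro m s t hst
    obtain ⟨c, hc, h1⟩ := hbw m s t hst
    have h2 : w m s t = c⁻¹ • ((W m).e s * b * (W m).e t) := by
      rw [h1, inv_smul_smul₀ hc]
    rw [h2]
    exact C.smul_mem (mul_mem (mul_mem (heC m s) hbC) (heC m t)) _
  have howner : ∀ m s t, Slot r m s t → O m s t → k m * (W m).e s ∈ C ∧ (W m).v s t ∈ C := by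
    intro m s t hst hOst
    have h1 := hwC m s t hst
    simp only [w, if_pos hst, if_pos hOst] at h1
    exact mem_of_mul_matrixUnit hC (hh _).2.1 (hh _).2.2 ((W m).isStarProjection_e s) (hke m s)
      ((W m).v_mul_star_v hst.2.2) ((W m).e_mul_v s t) (heC m s) h1
  have hvC : ∀ m s t, Slot r m s t → (W m).v s t ∈ C := by
    intro m s t hst
    by_cases h1 : O m s t
    · exact (howner m s t hst h1).2
    by_cases h2 : O m t s
    · rw [← (W m).star_v]
      exact star_mem (howner m t s hst.symm h2).2
    have h3 := hwC m s t hst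
    simpa only [w, if_pos hst, if_neg h1, if_neg h2] using h3
  refine hgen C hC (hhgen C hC fun n => ?_) (v_mem_of_slot heC hvC)
  -- h n is the sum of the h n e_s, each of which is recovered from the slot owned by s.
  rw [← mul_one (h n), ← (W (n + 1)).sum_v, Finset.mul_sum]
  refine sum_mem fun s _ => ?_
  obtain ⟨t, h1, h2⟩ := hslot n s
  exact (howner (n + 1) s t h1 h2).1

end MatrixUnitSystem

/-! ### Rotations of siblings, multiplicities and central covers. -/

/-- A full cycle on each fibre works: with length at least 3, neither it nor its square fixes a
point. The condition on the square is what makes the resulting orientation of pairs asymmetric. -/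
theorem exists_rotation_of_three_le_card_fiber {X K : Type*} [Fintype X] [DecidableEq X]
    [DecidableEq K] (f : X → K) (hf : ∀ s, 3 ≤ (Finset.univ.filter fun t => f t = f s).card) :
    ∃ σ : X → X, ∀ s, f (σ s) = f s ∧ σ s ≠ s ∧ σ (σ s) ≠ s := by
  choose π hπ hsupp using fun c : K => Finset.exists_cycleOn (Finset.univ.filter fun t => f t = c)
  have hmem : ∀ s, s ∈ Finset.univ.filter fun t => f t = f s := fun s => by simp
  have hfσ : ∀ s, f (π (f s) s) = f s := by
    intro s
    have := (hπ (f s)).1.mapsTo (Finset.mem_coe.2 (hmem s))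
    simpa using this
  have hne : ∀ s n, 0 < n → n < 3 → (π (f s) ^ n) s ≠ s := by
    intro s n h0 h3 h
    have := Nat.le_of_dvd h0 (((hπ (f s)).pow_apply_eq (hmem s)).1 h)
    have := hf s
    omega
  refine ⟨fun s => π (f s) s, fun s => ⟨hfσ s, hne s 1 one_pos (by norm_num), ?_⟩⟩
  simp only [hfσ]
  exact hne s 2 two_pos (by norm_num)

namespace MatrixUnitSystem

variable {B : Type*} [CStarAlgebra B] {U V W : MatrixUnitSystem B}

namespace Refinement

/-- The minimal projections of `V` under `x` which are of the same kind as `t`. -/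
def children (r : Refinement U V) (x : U.X) (t : V.X) : Finset V.X :=
  Finset.univ.filter fun s => V.kind s = V.kind t ∧ r.p s = x

theorem mem_children {r : Refinement U V} {x : U.X} {s t : V.X} :
    s ∈ r.children x t ↔ V.kind s = V.kind t ∧ r.p s = x := by
  simp [children]

theorem children_congr (r : Refinement U V) (x : U.X) {s t : V.X} (h : V.kind s = V.kind t) :
    r.children x s = r.children x t := by
  simp [children, h]

/-- Translation by the matrix unit from x to y injects the children of one into those of the other,
within a fixed kind. -/
theorem card_children_le (r : Refinement U V) {x y : U.X} (h : U.kind x = U.kind y) (t : V.X) :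
    (r.children x t).card ≤ (r.children y t).card := by
  choose! f hf1 hf2 hf3 using fun s => r.exists_translate x y s h
  refine Finset.card_le_card_of_injOn f ?_ ?_
  · intro s hs
    obtain ⟨h1, h2⟩ := mem_children.1 (Finset.mem_coe.1 hs)
    exact Finset.mem_coe.2 (mem_children.2 ⟨(hf2 s h2).symm.trans h1, hf1 s h2⟩)
  · intro s hs u hu hsu
    obtain ⟨-, h2⟩ := mem_children.1 (Finset.mem_coe.1 hs)
    obtain ⟨-, h2'⟩ := mem_children.1 (Finset.mem_coe.1 hu)
    by_contra hne
    apply V.v_self_ne_zero s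
    -- This product is e_s e_x e_u = e_s e_u = 0, yet with a common target it would be the nonzero
    -- unit joining s to u.
    have h3 : V.v s (f s) * star (V.v u (f u)) = 0 := by
      rw [← hf3 s h2, ← hf3 u h2', star_mul, V.star_e, mul_assoc, ← mul_assoc (U.v x y),
        U.v_mul_star_v h, ← mul_assoc, r.e_mul_e_of_eq h2, V.e_mul_e_of_ne hne]
    have h4 := hf2 u h2'
    rw [← hsu] at h3 h4
    rw [V.star_v, V.v_mul_v _ _ _ (hf2 s h2) h4.symm] at h3
    exact absurd h3 (V.v_ne_zero ((hf2 s h2).trans h4.symm))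

/-- The sum of the minimal projections of `V` whose kind occurs under `x`. -/
noncomputable def cover (r : Refinement U V) (x : U.X) : B :=
  ∑ s with (r.children x s).Nonempty, V.e s

variable (r : Refinement U V) (x : U.X)

theorem cover_mul_v (s t : V.X) :
    r.cover x * V.v s t = if (r.children x s).Nonempty then V.v s t else 0 := by
  rw [cover, Finset.sum_mul]
  split_ifs with h
  · rw [Finset.sum_eq_single s]
    · exact V.e_mul_v s t
    · exact fun u _ hu => V.e_mul_v_of_ne hu t
    · exact fun h' => absurd (by simpa using h) h'
  · refine Finset.sum_eq_zero fun u hu => V.e_mul_v_of_ne ?_ t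
    rintro rfl
    exact h (by simpa using hu)

theorem star_cover : star (r.cover x) = r.cover x := by
  simp only [cover, star_sum, V.star_e]

theorem v_mul_cover (s t : V.X) :
    V.v s t * r.cover x = if (r.children x t).Nonempty then V.v s t else 0 := by
  have := congrArg star (r.cover_mul_v x t s)
  rw [star_mul, star_cover, V.star_v] at this
  rw [this]
  split_ifs
  · rw [V.star_v]
  · rw [star_zero]

/-- Whether a kind occurs under x depends only on the kind, so the cover is a sum of whole summand
units. -/
theorem cover_commute {a : B} (ha : a ∈ V.linSpan) : r.cover x * a = a * r.cover x := by
  induction ha using Submodule.span_induction with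
  | mem a ha =>
    obtain ⟨⟨s, t⟩, rfl⟩ := ha
    simp only [cover_mul_v, v_mul_cover]
    by_cases h : V.kind s = V.kind t
    · rw [r.children_congr x h]
    · rw [V.v_eq_zero s t h]; simp
  | zero => simp
  | add a b _ _ ha hb => rw [mul_add, add_mul, ha, hb]
  | smul c a _ ha => rw [mul_smul_comm, smul_mul_assoc, ha]

theorem norm_cover_le : ‖r.cover x‖ ≤ 1 := by
  refine IsStarProjection.norm_le _ ⟨?_, r.star_cover x⟩
  rw [IsIdempotentElem]
  nth_rw 2 [cover]
  rw [Finset.mul_sum, cover]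
  refine Finset.sum_congr rfl fun s hs => ?_
  have := r.cover_mul_v x s s
  rw [if_pos (by simpa using hs)] at this
  exact this

theorem cover_mul_e : r.cover x * U.e x = U.e x := by
  conv_rhs => rw [← one_mul (U.e x), ← V.sum_v, Finset.sum_mul]
  rw [cover, Finset.sum_mul]
  refine Finset.sum_subset (Finset.subset_univ _) fun s _ hs => r.e_mul_e_of_ne fun h => hs ?_
  rw [Finset.mem_filter]
  exact ⟨Finset.mem_univ _, s, mem_children.2 ⟨rfl, h⟩⟩

/-- A kind missing under x gives a nonzero e_t annihilated by the cover, forcing the norm to be at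
least 1. -/
theorem children_nonempty_of_norm_lt (h : ‖r.cover x - 1‖ < 1) (t : V.X) :
    (r.children x t).Nonempty := by
  by_contra hne
  have h1 := r.cover_mul_v x t t
  rw [if_neg hne] at h1
  have h2 : ‖V.e t‖ = ‖(r.cover x - 1) * V.e t‖ := by
    rw [sub_mul, one_mul]
    change _ = ‖r.cover x * V.v t t - V.e t‖
    rw [h1, zero_sub, norm_neg]
  have h3 := norm_mul_le (r.cover x - 1) (V.e t)
  have h4 : 0 < ‖V.e t‖ := norm_pos_iff.2 (V.v_self_ne_zero t)
  nlinarith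

end Refinement

/-! ### Simplicity and infinite dimension force large multiplicities. -/

section Limit

variable {U : ℕ → MatrixUnitSystem B} {r : ∀ m, Refinement (U m) (U (m + 1))}
  {A : StarSubalgebra ℂ B}

theorem linSpan_mono (r : ∀ m, Refinement (U m) (U (m + 1))) :
    Monotone fun i => (U i).linSpan :=
  monotone_nat_of_le_succ fun i => (r i).linSpan_le

open Filter Topology in
theorem tendsto_cover_commutator (i : ℕ) (x : (U i).X) {a : B}
    (ha : a ∈ closure (⋃ i, ((U i).linSpan : Set B))) :
    Tendsto (fun j => (iterRefinement r i j).cover x * a - a * (iterRefinement r i j).cover x)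
      atTop (𝓝 0) := by
  rw [Metric.tendsto_atTop]
  intro ε hε
  obtain ⟨a', ha', hd⟩ := Metric.mem_closure_iff.1 ha (ε / 2) (by positivity)
  obtain ⟨l, hl⟩ := Set.mem_iUnion.1 ha'
  refine ⟨l, fun j hj => ?_⟩
  set z := (iterRefinement r i j).cover x with hz
  have h0 : z * a' = a' * z :=
    (iterRefinement r i j).cover_commute x (linSpan_mono r (show l ≤ i + j by omega) hl)
  have h1 : z * a - a * z = z * (a - a') - (a - a') * z := by
    rw [mul_sub, sub_mul, h0]; abel
  have hz1 : ‖z‖ ≤ 1 := (iterRefinement r i j).norm_cover_le x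
  rw [dist_zero_right, h1]
  rw [dist_eq_norm] at hd
  calc ‖z * (a - a') - (a - a') * z‖ ≤ ‖z * (a - a')‖ + ‖(a - a') * z‖ := norm_sub_le _ _
    _ ≤ ‖z‖ * ‖a - a'‖ + ‖a - a'‖ * ‖z‖ := add_le_add (norm_mul_le _ _) (norm_mul_le _ _)
    _ ≤ 1 * ‖a - a'‖ + ‖a - a'‖ * 1 := by gcongr
    _ < ε := by linarith

open Filter Topology in
-- The covers z_j of e_x are asymptotically central, so the y with z_j y → y form a closed ideal. It
-- contains e_x ≠ 0, hence by simplicity it contains 1. Thus z_j → 1, and once within distance 1 the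
-- cover misses no kind.
theorem eventually_children_nonempty (hA : AFAction.IsSimpleCStar A)
    (hle : ∀ i, ((U i).linSpan : Set B) ⊆ A)
    (hdense : (A : Set B) ⊆ closure (⋃ i, ((U i).linSpan : Set B))) (i : ℕ) (x : (U i).X) :
    ∀ᶠ j in atTop, ∀ t, ((iterRefinement r i j).children x t).Nonempty := by
  set z : ℕ → B := fun j => (iterRefinement r i j).cover x with hz
  have hz1 : ∀ j, ‖z j‖ ≤ 1 := fun j => (iterRefinement r i j).norm_cover_le x
  have hcomm : ∀ a ∈ A, Tendsto (fun j => z j * a - a * z j) atTop (𝓝 0) :=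
    fun a ha => tendsto_cover_commutator i x (hdense ha)
  let J : TwoSidedIdeal A := TwoSidedIdeal.mk'
    {y : A | Tendsto (fun j => z j * (y : B) - y) atTop (𝓝 0)}
    (by simp)
    (by
      intro y y' hy hy'
      have := Tendsto.add hy hy'
      rw [add_zero] at this
      refine this.congr fun j => ?_
      push_cast
      noncomm_ring)
    (by
      intro y hy
      have := Tendsto.neg hy
      rw [neg_zero] at this
      refine this.congr fun j => ?_
      push_cast
      noncomm_ring)
    -- Left multiplication needs asymptotic centrality: z a y - a y = (z a - a z) y + a (z y - y).
    (by
      intro a y hy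
      have h1 := ((hcomm a a.2).mul_const (y : B)).add (Tendsto.const_mul (a : B) hy)
      rw [zero_mul, mul_zero, add_zero] at h1
      refine h1.congr fun j => ?_
      push_cast
      noncomm_ring)
    (by
      intro y a hy
      have h1 := Tendsto.mul_const (a : B) hy
      rw [zero_mul] at h1
      refine h1.congr fun j => ?_
      push_cast
      noncomm_ring)
  have hJmem : ∀ y : A, y ∈ J ↔ Tendsto (fun j => z j * (y : B) - y) atTop (𝓝 0) := fun y => by
    simp only [J, TwoSidedIdeal.mem_mk', Set.mem_ofPred_eq]
  have hJ : IsClosed (J : Set A) := by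
    rw [← isSeqClosed_iff_isClosed]
    intro y y₀ hy hlim
    change y₀ ∈ J
    rw [hJmem, Metric.tendsto_atTop]
    intro ε hε
    obtain ⟨n, hn⟩ := (Metric.tendsto_atTop.1 hlim (ε / 3) (by positivity))
    have hn := hn n le_rfl
    obtain ⟨j0, hj0⟩ := Metric.tendsto_atTop.1 ((hJmem _).1 (hy n)) (ε / 3) (by positivity)
    refine ⟨j0, fun j hj => ?_⟩
    have h1 := hj0 j hj
    rw [dist_zero_right] at h1 ⊢
    rw [dist_comm, Subtype.dist_eq, dist_eq_norm] at hn
    have h2 : z j * (y₀ : B) - y₀ =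
        z j * ((y₀ : B) - y n) + (z j * (y n : B) - y n) - ((y₀ : B) - y n) := by
      noncomm_ring
    rw [h2]
    calc _ ≤ ‖z j * ((y₀ : B) - y n)‖ + ‖z j * (y n : B) - y n‖ + ‖(y₀ : B) - y n‖ :=
          (norm_sub_le _ _).trans (by gcongr; exact norm_add_le _ _)
      _ ≤ 1 * ‖(y₀ : B) - y n‖ + ‖z j * (y n : B) - y n‖ + ‖(y₀ : B) - y n‖ := by
          gcongr
          exact (norm_mul_le _ _).trans (by gcongr; exact hz1 j)
      _ < ε := by linarith
  have heA : (U i).e x ∈ A := hle i ((U i).v_mem x x)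
  have hxJ : (⟨(U i).e x, heA⟩ : A) ∈ J := by
    rw [hJmem]
    refine tendsto_const_nhds.congr fun j => ?_
    simp only [hz, (iterRefinement r i j).cover_mul_e, sub_self]
  have hJtop : J = ⊤ := by
    refine (hA.2 J hJ).resolve_left fun h => ?_
    rw [h, TwoSidedIdeal.mem_bot] at hxJ
    exact (U i).v_self_ne_zero x (congrArg Subtype.val hxJ)
  have h1 : (1 : A) ∈ J := by rw [hJtop]; trivial
  rw [hJmem] at h1
  have h2 := (Metric.tendsto_nhds.1 h1) 1 one_pos
  filter_upwards [h2] with j hj t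
  refine (iterRefinement r i j).children_nonempty_of_norm_lt x ?_ t
  simpa [dist_zero_right, hz] using hj

/-- With bounded size the increasing spans stabilise, and a finite-dimensional span is closed, so it
already contains A. -/
theorem finiteDimensional_of_card_le (hA : (A : Set B) ⊆ closure (⋃ i, ((U i).linSpan : Set B)))
    (r : ∀ m, Refinement (U m) (U (m + 1))) {R : ℕ} (hR : ∀ i, Fintype.card (U i).X ≤ R) :
    FiniteDimensional ℂ A := by
  have hfin : ∀ i, FiniteDimensional ℂ (U i).linSpan := fun i =>
    FiniteDimensional.span_of_finite ℂ (Set.finite_range _)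
  have hrank : ∀ i, Module.finrank ℂ (U i).linSpan ≤ R * R := by
    intro i
    refine (finrank_range_le_card _).trans ?_
    rw [Fintype.card_prod]
    exact Nat.mul_le_mul (hR i) (hR i)
  have hmono := linSpan_mono r
  have hbdd : BddAbove (Set.range fun i => Module.finrank ℂ (U i).linSpan) :=
    ⟨R * R, by rintro _ ⟨i, rfl⟩; exact hrank i⟩
  obtain ⟨i, hi⟩ : ∃ i, ∀ k, Module.finrank ℂ (U k).linSpan ≤ Module.finrank ℂ (U i).linSpan := by
    obtain ⟨i, hi⟩ := Nat.sSup_mem (Set.range_nonempty _) hbdd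
    exact ⟨i, fun k => (le_csSup hbdd ⟨k, rfl⟩).trans_eq hi.symm⟩
  have hle : ∀ k, (U k).linSpan ≤ (U i).linSpan := by
    intro k
    have h1 : (U i).linSpan ≤ (U (max i k)).linSpan := hmono (le_max_left i k)
    have h2 := Submodule.eq_of_le_of_finrank_le h1 (hi _)
    rw [h2]
    exact hmono (le_max_right i k)
  have hAle : A.toSubmodule ≤ (U i).linSpan := by
    intro a ha
    have hcl : IsClosed ((U i).linSpan : Set B) := Submodule.closed_of_finiteDimensional _
    exact hcl.closure_subset_iff.2 (Set.iUnion_subset fun k => hle k) (hA ha)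
  exact Submodule.finiteDimensional_of_le hAle

/-- At stage I every kind occurs under every x. A later stage k has so many projections of each kind
that pigeonhole puts N of them under a single y of stage I. Some y' under x is equivalent to y and
therefore has just as many. -/
theorem exists_refinement_card_children [Nontrivial B] (r : ∀ m, Refinement (U m) (U (m + 1)))
    (hA : AFAction.IsSimpleCStar A)
    (hinf : ¬FiniteDimensional ℂ A) (hle : ∀ i, ((U i).linSpan : Set B) ⊆ A)
    (hdense : (A : Set B) ⊆ closure (⋃ i, ((U i).linSpan : Set B))) (N i : ℕ) :
    ∃ k, i < k ∧ ∃ ρ : Refinement (U i) (U k), ∀ x t, N ≤ (ρ.children x t).card := by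
  have hev : ∀ i, ∃ j0, ∀ j ≥ j0, ∀ x t, ((iterRefinement r i j).children x t).Nonempty := by
    intro i
    rw [← Filter.eventually_atTop, Filter.eventually_all]
    exact fun x => eventually_children_nonempty hA hle hdense i x
  obtain ⟨j1, hj1⟩ := hev i
  set I := i + j1 with hI
  obtain ⟨J, hJ⟩ : ∃ J, Fintype.card (U I).X * N ≤ Fintype.card (U J).X := by
    by_contra! h
    exact hinf (finiteDimensional_of_card_le hdense r fun k => (h k).le)
  obtain ⟨j2, hj2⟩ := hev J
  -- Chosen past both J + j2 and I; the extra 1 makes i < k.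
  obtain ⟨k, hk⟩ : ∃ k, k = J + (j2 + I + 1) := ⟨_, rfl⟩
  obtain ⟨j3, hj3⟩ : ∃ j3, k = I + j3 := ⟨k - I, by omega⟩
  let ρ₁ : Refinement (U i) (U I) := iterRefinement r i j1
  obtain ⟨ρ₂⟩ : Nonempty (Refinement (U I) (U k)) := ⟨hj3 ▸ iterRefinement r I j3⟩
  obtain ⟨ρ₃, hρ₃⟩ : ∃ ρ : Refinement (U J) (U k), ∀ x t, (ρ.children x t).Nonempty := by
    rw [hk]
    exact ⟨iterRefinement r J (j2 + I + 1), hj2 _ (by omega)⟩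
  refine ⟨k, by omega, ρ₁.comp ρ₂, fun x t => ?_⟩
  set S : Finset (U k).X := Finset.univ.filter fun s => (U k).kind s = (U k).kind t with hS
  have hScard : Fintype.card (U J).X ≤ S.card := by
    rw [← Finset.card_univ]
    refine Finset.card_le_card_of_surjOn ρ₃.p ?_
    intro y _
    obtain ⟨s, hs⟩ := hρ₃ y t
    obtain ⟨h1, h2⟩ := Refinement.mem_children.1 hs
    exact ⟨s, by simpa [hS] using h1, h2⟩
  have : Nonempty (U I).X := (U I).nonempty_X
  obtain ⟨y, -, hy⟩ := Finset.exists_le_card_fiber_of_mul_le_card_of_maps_to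
    (s := S) (t := Finset.univ) (f := ρ₂.p) (n := N) (fun _ _ => Finset.mem_univ _)
    Finset.univ_nonempty (by rw [Finset.card_univ]; exact hJ.trans hScard)
  obtain ⟨y', hy'⟩ := hj1 j1 le_rfl x y
  obtain ⟨h1, h2⟩ := Refinement.mem_children.1 hy'
  refine (hy.trans ?_).trans ((ρ₂.card_children_le h1.symm t).trans (Finset.card_le_card ?_))
  · refine Finset.card_le_card fun s hs => ?_
    simp only [hS, Finset.mem_filter, Finset.mem_univ, true_and] at hs
    exact Refinement.mem_children.2 hs
  · intro s hs
    obtain ⟨h3, h4⟩ := Refinement.mem_children.1 hs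
    exact Refinement.mem_children.2 ⟨h3, by rw [← h2, ← h4]; rfl⟩

end Limit

/-! ### Assembly along a sparse subsequence. -/

/-- A sequence of matrix unit systems with multiplicities at least three, whose diagonals commute
with `D`, yields a single generator. -/
theorem exists_elemental_eq_top_of_three_le_card [Nontrivial B] {W : ℕ → MatrixUnitSystem B}
    (r : ∀ m, Refinement (W m) (W (m + 1)))
    (h3 : ∀ m x t, 3 ≤ ((r m).children x t).card)
    (D : StarSubalgebra ℂ B) (hD : TopologicalSpace.IsSeparable (D : Set B))
    (hcomm : ∀ d ∈ D, ∀ m s, d * (W m).e s = (W m).e s * d) (heD : ∀ m s, (W m).e s ∈ D)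
    (hgen : ∀ C : StarSubalgebra ℂ B, IsClosed (C : Set B) → D ≤ C →
      (∀ m s t, (W m).v s t ∈ C) → C = ⊤) :
    ∃ g : B, StarAlgebra.elemental ℂ g = ⊤ := by
  have hrot : ∀ m, ∃ σ : (W (m + 1)).X → (W (m + 1)).X, ∀ s,
      ((W (m + 1)).kind (σ s), (r m).p (σ s)) = ((W (m + 1)).kind s, (r m).p s) ∧
        σ s ≠ s ∧ σ (σ s) ≠ s := by
    intro m
    refine exists_rotation_of_three_le_card_fiber
      (fun s => ((W (m + 1)).kind s, (r m).p s)) fun s => ?_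
    refine (h3 m ((r m).p s) s).trans (Finset.card_le_card fun t ht => ?_)
    obtain ⟨h1, h2⟩ := Refinement.mem_children.1 ht
    simp [h1, h2]
  choose σ hσ hσ1 hσ2 using hrot
  refine exists_elemental_eq_top (r := r) D hD hcomm heD
    (fun m => match m with
      | 0 => fun _ _ => False
      | m + 1 => fun s t => t = σ m s) ?_ ?_ hgen
  · intro m s t
    match m with
    | 0 => exact fun h => h.elim
    | m + 1 =>
      rintro rfl h
      exact hσ2 m s h.symm
  · intro m s
    obtain ⟨h1, h2⟩ := Prod.mk.inj (hσ m s)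
    -- Siblings share all their ancestors, so they are fresh and form a slot.
    refine ⟨σ m s, ⟨⟨?_, fun h => h.1 h2.symm⟩, (hσ1 m s).symm, h1.symm⟩, rfl⟩
    rw [h2]
    exact fresh_self r m _

theorem exists_elemental_eq_top_of_isSimpleCStar [Nontrivial B] {U : ℕ → MatrixUnitSystem B}
    (r : ∀ m, Refinement (U m) (U (m + 1))) {A : StarSubalgebra ℂ B}
    (hA : AFAction.IsSimpleCStar A) (hinf : ¬FiniteDimensional ℂ A)
    (hle : ∀ i, ((U i).linSpan : Set B) ⊆ A)
    (hdense : (A : Set B) ⊆ closure (⋃ i, ((U i).linSpan : Set B)))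
    (D : StarSubalgebra ℂ B) (hD : TopologicalSpace.IsSeparable (D : Set B))
    (hcomm : ∀ d ∈ D, ∀ m s, d * (U m).e s = (U m).e s * d) (heD : ∀ m s, (U m).e s ∈ D)
    (hgen : ∀ C : StarSubalgebra ℂ B, IsClosed (C : Set B) → D ≤ C → A ≤ C → C = ⊤) :
    ∃ g : B, StarAlgebra.elemental ℂ g = ⊤ := by
  choose f hf ρ hρ using exists_refinement_card_children r hA hinf hle hdense 3
  let N : ℕ → ℕ := fun m => Nat.rec 0 (fun _ i => f i) m
  have hN : ∀ m, m ≤ N m := by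
    intro m
    induction m with
    | zero => exact Nat.zero_le _
    | succ m ih => exact (Nat.succ_le_succ ih).trans (hf (N m))
  refine exists_elemental_eq_top_of_three_le_card (W := fun m => U (N m)) (fun m => ρ (N m))
    (fun m => hρ (N m)) D hD (fun d hd m => hcomm d hd (N m)) (fun m => heD (N m))
    fun C hC hDC hv => hgen C hC hDC fun a ha => ?_
  refine hC.closure_subset_iff.2 (Set.iUnion_subset fun i => ?_) (hdense ha)
  refine Set.Subset.trans (linSpan_mono r (hN i)) ?_
  change (U (N i)).linSpan ≤ C.toSubmodule
  rw [linSpan, Submodule.span_le]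
  rintro _ ⟨⟨s, t⟩, rfl⟩
  exact hv i s t

end MatrixUnitSystem

/-! ### From canonical decompositions to matrix unit systems in B. -/

namespace AFAction

namespace CanonicalSequence

variable (S : CanonicalSequence)

/-- The minimal diagonal projections of the stage `i`. -/
abbrev Index (i : ℕ) : Type := (j : Fin (S.K i)) × Fin (S.n i j)

/-- The matrix unit of the stage `i` at `x, y`, which is zero unless `x` and `y` belong to the same
summand. -/
def unit (i : ℕ) (x y : S.Index i) : S.Stage i :=
  fun j => Matrix.of fun a b => if (⟨j, a⟩ : S.Index i) = x ∧ (⟨j, b⟩ : S.Index i) = y then 1 else 0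

theorem unit_apply (i : ℕ) (x y : S.Index i) (j : Fin (S.K i)) (a b : Fin (S.n i j)) :
    S.unit i x y j a b =
      if (⟨j, a⟩ : S.Index i) = x ∧ (⟨j, b⟩ : S.Index i) = y then 1 else 0 := rfl

theorem unit_eq_matrixUnit (i : ℕ) (j : Fin (S.K i)) (a b : Fin (S.n i j)) :
    S.unit i ⟨j, a⟩ ⟨j, b⟩ = S.matrixUnit i j a b := by
  funext j'
  ext c d
  rw [unit_apply, matrixUnit]
  by_cases h : j' = j
  · subst h
    simp [Matrix.single_apply, eq_comm]
  · simp [h]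

theorem unit_eq_zero (i : ℕ) {x y : S.Index i} (h : x.1 ≠ y.1) : S.unit i x y = 0 := by
  funext j
  ext a b
  rw [unit_apply, if_neg]
  · rfl
  · rintro ⟨rfl, rfl⟩
    exact h rfl

theorem star_unit (i : ℕ) (x y : S.Index i) : star (S.unit i x y) = S.unit i y x := by
  funext j
  ext a b
  rw [Pi.star_apply, Matrix.star_apply, unit_apply, unit_apply]
  simp only [and_comm]
  split_ifs <;> simp

theorem unit_mul_apply (i : ℕ) (x y : S.Index i) (z : S.Stage i) (j : Fin (S.K i))
    (a b : Fin (S.n i j)) :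
    (S.unit i x y * z) j a b = ∑ c, S.unit i x y j a c * z j c b := by
  rw [Pi.mul_apply, Matrix.mul_apply]

theorem unit_mul_unit (i : ℕ) {x y : S.Index i} (z : S.Index i) (h : x.1 = y.1) :
    S.unit i x y * S.unit i y z = S.unit i x z := by
  funext j
  ext a b
  rw [unit_mul_apply]
  simp only [unit_apply]
  by_cases hj : j = y.1
  · obtain ⟨y1, y2⟩ := y
    subst hj
    rw [Finset.sum_eq_single y2]
    · simp only [and_true, true_and]
      split_ifs <;> simp_all
    · intro c _ hc
      simp [hc]
    · simp
  · rw [if_neg]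
    · refine Finset.sum_eq_zero fun c _ => ?_
      rw [if_neg, zero_mul]
      rintro ⟨-, rfl⟩
      exact hj rfl
    · rintro ⟨rfl, -⟩
      exact hj h

theorem unit_mul_unit_of_ne (i : ℕ) (x : S.Index i) {y y' : S.Index i} (z : S.Index i)
    (h : y ≠ y') : S.unit i x y * S.unit i y' z = 0 := by
  funext j
  ext a b
  rw [unit_mul_apply]
  refine Finset.sum_eq_zero fun c _ => ?_
  simp only [unit_apply]
  split_ifs with h1 h2
  · exact absurd (h1.2.symm.trans h2.1) h
  all_goals simp

theorem sum_unit (i : ℕ) : ∑ x, S.unit i x x = 1 := by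
  funext j
  ext a b
  rw [Finset.sum_apply, Matrix.sum_apply, Pi.one_apply, Matrix.one_apply,
    Finset.sum_eq_single (⟨j, a⟩ : S.Index i)]
  · rw [unit_apply]
    simp [eq_comm]
  · intro x _ hx
    rw [unit_apply, if_neg]
    exact fun h => hx h.1.symm
  · simp

theorem eq_sum_unit (i : ℕ) (z : S.Stage i) :
    z = ∑ j, ∑ a, ∑ b, z j a b • S.unit i ⟨j, a⟩ ⟨j, b⟩ := by
  funext j
  ext a b
  simp only [Finset.sum_apply, Matrix.sum_apply, Pi.smul_apply, Matrix.smul_apply]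
  rw [Finset.sum_eq_single j, Finset.sum_eq_single a, Finset.sum_eq_single b]
  · simp [unit_apply]
  · intro c _ hc
    simp [unit_apply, hc.symm]
  · simp
  · intro c _ hc
    simp [unit_apply, hc.symm]
  · simp
  · intro c _ hc
    simp [unit_apply, hc.symm]
  · simp

/-- The minimal projection of the stage `i` above a minimal projection of the stage `i + 1`. -/
def parent (i : ℕ) (s : S.Index (i + 1)) : S.Index i :=
  ⟨((S.L i s.1).symm s.2).1.1, ((S.L i s.1).symm s.2).2⟩

theorem parent_L (i : ℕ) (j : Fin (S.K (i + 1))) (c : (j' : Fin (S.K i)) × Fin (S.m i j' j))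
    (a : Fin (S.n i c.1)) : S.parent i ⟨j, S.L i j ⟨c, a⟩⟩ = ⟨c.1, a⟩ := by
  rw [parent, Equiv.symm_apply_apply]

theorem connect_unit_apply (i : ℕ) (x y : S.Index i) (j : Fin (S.K (i + 1)))
    (p q : (c : (j' : Fin (S.K i)) × Fin (S.m i j' j)) × Fin (S.n i c.1)) :
    S.connect i (S.unit i x y) j (S.L i j p) (S.L i j q) =
      if (⟨p.1.1, p.2⟩ : S.Index i) = x ∧ (⟨q.1.1, q.2⟩ : S.Index i) = y ∧ p.1 = q.1
        then 1 else 0 := by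
  simp only [connect, Matrix.reindex_apply, Matrix.submatrix_apply, Equiv.symm_apply_apply]
  obtain ⟨c, a⟩ := p
  obtain ⟨d, b⟩ := q
  rw [Matrix.blockDiagonal'_apply]
  by_cases h : c = d
  · subst h
    simp [unit_apply]
  · simp [h]

theorem unit_self_mul_apply (i : ℕ) (s : S.Index i) (z : S.Stage i) (j : Fin (S.K i))
    (a b : Fin (S.n i j)) :
    (S.unit i s s * z) j a b = if (⟨j, a⟩ : S.Index i) = s then z j a b else 0 := by
  rw [unit_mul_apply]
  split_ifs with h
  · subst h
    rw [Finset.sum_eq_single a]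
    · simp [unit_apply]
    · intro c _ hc
      simp [unit_apply, hc]
    · simp
  · refine Finset.sum_eq_zero fun c _ => ?_
    rw [unit_apply, if_neg (fun h' => h h'.1), zero_mul]

/-- Multiplying by one diagonal unit keeps a single row, which meets only the block copy c; the
connected unit has one nonzero entry there. -/
theorem unit_mul_connect (i : ℕ) (j : Fin (S.K (i + 1)))
    (c : (j' : Fin (S.K i)) × Fin (S.m i j' j)) (a b : Fin (S.n i c.1)) :
    S.unit (i + 1) ⟨j, S.L i j ⟨c, a⟩⟩ ⟨j, S.L i j ⟨c, a⟩⟩ *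
      S.connect i (S.unit i ⟨c.1, a⟩ ⟨c.1, b⟩) =
      S.unit (i + 1) ⟨j, S.L i j ⟨c, a⟩⟩ ⟨j, S.L i j ⟨c, b⟩⟩ := by
  funext j'
  ext a' b'
  rw [unit_self_mul_apply, unit_apply]
  by_cases h : (⟨j', a'⟩ : S.Index (i + 1)) = ⟨j, S.L i j ⟨c, a⟩⟩
  · obtain ⟨rfl, h⟩ := Sigma.mk.inj h
    obtain rfl := eq_of_heq h
    obtain ⟨⟨d, b1⟩, rfl⟩ := (S.L i j').surjective b'
    rw [connect_unit_apply]
    simp only [if_true, true_and]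
    refine if_congr ?_ rfl rfl
    constructor
    · rintro ⟨h1, rfl⟩
      have : b1 = b := by simpa using h1
      rw [this]
    · intro h1
      have h2 : (⟨d, b1⟩ : (c : (j'' : Fin (S.K i)) × Fin (S.m i j'' j')) × Fin (S.n i c.1)) =
          ⟨c, b⟩ := by simpa using h1
      cases h2
      exact ⟨rfl, rfl⟩
  · rw [if_neg h, if_neg fun h' => h h'.1]

theorem unit_mul_connect_self (i : ℕ) (s : S.Index (i + 1)) :
    S.unit (i + 1) s s * S.connect i (S.unit i (S.parent i s) (S.parent i s)) =
      S.unit (i + 1) s s := by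
  obtain ⟨j, a⟩ := s
  obtain ⟨⟨c, a⟩, rfl⟩ := (S.L i j).surjective a
  rw [parent_L, unit_mul_connect]

theorem exists_unit_mul_connect (i : ℕ) (x y : S.Index i) (s : S.Index (i + 1)) (h : x.1 = y.1)
    (hs : S.parent i s = x) :
    ∃ s', S.parent i s' = y ∧ s.1 = s'.1 ∧
      S.unit (i + 1) s s * S.connect i (S.unit i x y) = S.unit (i + 1) s s' := by
  obtain ⟨j, a⟩ := s
  obtain ⟨⟨c, a⟩, rfl⟩ := (S.L i j).surjective a
  rw [parent_L] at hs
  subst hs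
  obtain ⟨y1, b⟩ := y
  simp only at h
  subst h
  exact ⟨⟨j, S.L i j ⟨c, b⟩⟩, S.parent_L i j c b, rfl, S.unit_mul_connect i j c a b⟩

end CanonicalSequence

namespace CanonicalDecomposition

variable {B : Type*} [CStarAlgebra B] {A : StarSubalgebra ℂ B} (C : CanonicalDecomposition A)

/-- The canonical matrix units of the stage `i` in `B`. -/
def unit (i : ℕ) (x y : C.toCanonicalSequence.Index i) : B :=
  C.ι i (C.toCanonicalSequence.unit i x y)

/-- The nonzero canonical matrix units of the stage `i`. -/
noncomputable def system (i : ℕ) : MatrixUnitSystem B where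
  -- Zero multiplicities may kill a summand in the limit, so vanishing projections are discarded.
  X := {x : C.toCanonicalSequence.Index i // C.unit i x x ≠ 0}
  fintypeX := Fintype.ofFinite _
  decEqX := Classical.decEq _
  kind x := x.1.1
  v x y := C.unit i x y
  star_v x y := by rw [unit, ← map_star, CanonicalSequence.star_unit]; rfl
  v_mul_v x y z h _ := by
    simp only [unit]
    rw [← map_mul, CanonicalSequence.unit_mul_unit _ _ _ (Fin.ext h)]
  v_mul_v_of_ne x y y' z h := by
    simp only [unit]
    rw [← map_mul, CanonicalSequence.unit_mul_unit_of_ne _ _ _ _ fun h' => h (Subtype.ext h'),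
      map_zero]
  v_eq_zero x y h := by
    simp only [unit]
    rw [CanonicalSequence.unit_eq_zero _ _ fun h' => h (congrArg Fin.val h'), map_zero]
  sum_v := by
    rw [← map_one (C.ι i), ← CanonicalSequence.sum_unit, map_sum]
    classical
    let := Fintype.ofFinite {x : C.toCanonicalSequence.Index i // C.unit i x x ≠ 0}
    exact (Finset.sum_subtype (p := fun x => C.unit i x x ≠ 0)
      (Finset.univ.filter fun x => C.unit i x x ≠ 0) (fun x => by simp)
      fun x => C.unit i x x).symm.trans (Finset.sum_filter_ne_zero _)
  v_self_ne_zero x := x.2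

theorem unit_mul_unit_connect {i : ℕ} {x y : C.toCanonicalSequence.Index i}
    {s t : C.toCanonicalSequence.Index (i + 1)}
    (h : C.toCanonicalSequence.unit (i + 1) s s * C.toCanonicalSequence.connect i
      (C.toCanonicalSequence.unit i x y) = C.toCanonicalSequence.unit (i + 1) s t) :
    C.unit (i + 1) s s * C.unit i x y = C.unit (i + 1) s t := by
  simp only [unit]
  rw [← C.ι_connect i, ← map_mul, h]

/-- Each stage is refined by the next. -/
noncomputable def refinement (i : ℕ) :
    MatrixUnitSystem.Refinement (C.system i) (C.system (i + 1)) where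
  p s := ⟨C.toCanonicalSequence.parent i s.1, fun h => s.2 <| by
    rw [← C.unit_mul_unit_connect (C.toCanonicalSequence.unit_mul_connect_self i s.1), h, mul_zero]⟩
  e_mul_e s := C.unit_mul_unit_connect (C.toCanonicalSequence.unit_mul_connect_self i s.1)
  exists_translate := by
    intro x y s h hs
    obtain ⟨t, h1, h2, h3⟩ := C.toCanonicalSequence.exists_unit_mul_connect i x.1 y.1 s.1
      (Fin.ext h) (congrArg Subtype.val hs)
    -- e_s factors through e_t, so the translate survives in B whenever s does.
    have ht : C.unit (i + 1) t t ≠ 0 := by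
      intro h0
      apply s.2
      have h4 : C.unit (i + 1) s.1 s.1 =
          C.unit (i + 1) s.1 t * C.unit (i + 1) t t * C.unit (i + 1) t s.1 := by
        simp only [unit]
        rw [← map_mul, ← map_mul, CanonicalSequence.unit_mul_unit _ _ _ h2,
          CanonicalSequence.unit_mul_unit _ _ _ h2]
      rw [h4, h0, mul_zero, zero_mul]
    exact ⟨⟨t, ht⟩, Subtype.ext h1, congrArg Fin.val h2, C.unit_mul_unit_connect h3⟩

theorem unit_mem_linSpan (i : ℕ) (x y : C.toCanonicalSequence.Index i) :
    C.unit i x y ∈ (C.system i).linSpan := by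
  have hmul : x.1 = y.1 → C.unit i x x * C.unit i x y = C.unit i x y ∧
      C.unit i x y * C.unit i y y = C.unit i x y := by
    intro h
    simp only [unit]
    rw [← map_mul, ← map_mul, CanonicalSequence.unit_mul_unit _ _ _ rfl,
      CanonicalSequence.unit_mul_unit _ _ _ h]
    exact ⟨rfl, rfl⟩
  by_cases h : x.1 = y.1
  swap
  · rw [unit, CanonicalSequence.unit_eq_zero _ _ h, map_zero]
    exact zero_mem _
  by_cases hx : C.unit i x x = 0
  · rw [← (hmul h).1, hx, zero_mul]
    exact zero_mem _
  by_cases hy : C.unit i y y = 0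
  · rw [← (hmul h).2, hy, mul_zero]
    exact zero_mem _
  exact (C.system i).v_mem ⟨x, hx⟩ ⟨y, hy⟩

theorem linSpan_system (i : ℕ) : ((C.system i).linSpan : Set B) = Set.range (C.ι i) := by
  apply Set.Subset.antisymm
  · change (C.system i).linSpan ≤ LinearMap.range (C.ι i).toAlgHom.toLinearMap
    rw [MatrixUnitSystem.linSpan, Submodule.span_le]
    rintro _ ⟨⟨s, t⟩, rfl⟩
    exact ⟨_, rfl⟩
  · rintro _ ⟨z, rfl⟩
    rw [C.toCanonicalSequence.eq_sum_unit i z]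
    simp only [map_sum, map_smul]
    exact sum_mem fun j _ => sum_mem fun a _ => sum_mem fun b _ =>
      Submodule.smul_mem _ _ (C.unit_mem_linSpan i _ _)

theorem unit_self_mem_projectionsAt (i : ℕ) (x : C.toCanonicalSequence.Index i) :
    C.unit i x x ∈ C.projectionsAt i x.1 := by
  refine ⟨⟨x.2, x.2, ?_⟩, ?_⟩
  · rw [← CanonicalSequence.unit_eq_matrixUnit]; rfl
  · rw [unit, ← map_star, CanonicalSequence.star_unit]

theorem unit_self_mem_units (i : ℕ) (x : C.toCanonicalSequence.Index i) :
    C.unit i x x ∈ C.units :=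
  Set.mem_iUnion.2 ⟨i, Set.mem_iUnion.2 ⟨x.1, (C.unit_self_mem_projectionsAt i x).1⟩⟩

theorem unit_self_mem_diagonal (i : ℕ) (x : C.toCanonicalSequence.Index i) :
    C.unit i x x ∈ C.diagonal :=
  NonUnitalStarSubalgebra.le_topologicalClosure _ (NonUnitalStarAlgebra.subset_adjoin ℂ _
    (Set.mem_iUnion.2 ⟨i, Set.mem_iUnion.2 ⟨x.1, C.unit_self_mem_projectionsAt i x⟩⟩))

end CanonicalDecomposition

end AFAction

theorem theorem3p6 (B : Type*) [CStarAlgebra B] (hB : AFAction.HasAFAction B) :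
    AFAction.SinglyGenerated B := by
  obtain ⟨A, D, -, hA, hinf, -, -, hD, C, hgen, hcomm, hconj⟩ := hB
  have : Nontrivial A := hA.1
  have : Nontrivial B := Subtype.val_injective.nontrivial (α := A)
  have hcl : closure (⋃ i, ((C.system i).linSpan : Set B)) = A := by
    simp only [C.linSpan_system]
    exact C.closure_range
  obtain ⟨g, hg⟩ := MatrixUnitSystem.exists_elemental_eq_top_of_isSimpleCStar
    (U := C.system) C.refinement hA hinf
    (fun i => hcl ▸ (Set.subset_iUnion (fun i => ((C.system i).linSpan : Set B)) i).trans
      subset_closure)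
    hcl.ge D hD
    (fun d hd i s => hcomm d hd _ (C.unit_self_mem_diagonal i s.1))
    -- Applying the conjugation condition to d = 1 and v = e_s puts every diagonal projection in D.
    (fun i s => by
      have h := hconj 1 (one_mem D) _ (C.unit_self_mem_units i s.1)
      rw [mul_one] at h
      have h2 : (C.system i).e s * star ((C.system i).e s) ∈ D := h
      rwa [(C.system i).star_e, (C.system i).e_mul_e_self] at h2)
    (fun E hE hDE hAE => by
      have hle : AFAction.cstarGen ((A : Set B) ∪ D) ≤ E.toNonUnitalStarSubalgebra :=
        NonUnitalStarSubalgebra.topologicalClosure_minimal _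
          (NonUnitalStarAlgebra.adjoin_le (Set.union_subset hAE hDE)) hE
      rw [hgen] at hle
      rw [eq_top_iff]
      exact fun x _ => hle (x := x) trivial)
  exact singlyGenerated_of_elemental_eq_top g hg
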